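/- Let $(z_1,z_2,w)$ be coordinates on $\mathbb{C}^3$, $w=u+iv$, and let $U\subset\mathbb{C}^2_{(z_1,z_2)}$ be a non-empty connected open set on which $1-z_2\bar z_2\neq 0$ (for instance a small ball around the origin). Let $$M_{\mathrm{LC}}:\quad u=\frac{z_1\bar z_1+\frac12 z_1^2\bar z_2+\frac12\bar z_1^2z_2}{1-z_2\bar z_2},\qquad (z_1,z_2)\in U,$$ and let $\mathfrak{hol}_{\mathrm{rigid}}(M_{\mathrm{LC}})$ be the set of infinitesimal rigid biholomorphisms of $M_{\mathrm{LC}}$, that is, of the holomorphic vector fields on $U\times\mathbb{C}$ of the form $$X=A_1(z_1,z_2)\,\partial_{z_1}+A_2(z_1,z_2)\,\partial_{z_2}+\big(\alpha w+B(z_1,z_2)\big)\,\partial_w,$$ with $A_1,A_2,B$ holomorphic on $U$ and $\alpha\in\mathbb{R}$, such that $X+\overline X$ is tangent to $M_{\mathrm{LC}}$ at every point of $M_{\mathrm{LC}}$. Then $\mathfrak{hol}_{\mathrm{rigid}}(M_{\mathrm{LC}})$ is a real Lie algebra under the Lie bracket of vector fields, it has real dimension exactly $7$, and the (restrictions to $U\times\mathbb{C}$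 of the) following seven fields are linearly independent over $\mathbb{R}$ and span it over $\mathbb{R}$: $$\begin{aligned} X^1&=i\,\partial_w,\\ X^2&=z_1\partial_{z_1}+2w\,\partial_w,\\ X^3&=iz_1\partial_{z_1}+2iz_2\partial_{z_2},\\ X^4&=(z_2-1)\partial_{z_1}-2z_1\partial_w,\\ X^5&=(i+iz_2)\partial_{z_1}-2iz_1\partial_w,\\ X^6&=z_1z_2\partial_{z_1}+(z_2^2-1)\partial_{z_2}-z_1^2\partial_w,\\ X^7&=iz_1z_2\partial_{z_1}+(iz_2^2+i)\partial_{z_2}-iz_1^2\partial_w. \end{aligned}$$ -/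

import Mathlib

open TopologicalSpace ComplexConjugate

noncomputable section

namespace RigidCR

/-- `ℂ³` with coordinates `(z₁, z₂, w)`: a point `p` has `p.1 = (z₁, z₂)` and `p.2 = w`. -/
abbrev C3 : Type := (ℂ × ℂ) × ℂ

/-- The real vector space of holomorphic vector fields
`X = X₁ ∂_{z₁} + X₂ ∂_{z₂} + X₃ ∂_w` on an open set `Ω ⊆ ℂ³`. Such a field is recorded by its
coefficient vector `p ↦ ((X₁ p, X₂ p), X₃ p)`, extended by `0` outside `Ω`, so that two fields are
equal precisely when they agree on `Ω`. -/
def HolVF (Ω : Opens C3) : Submodule ℝ (C3 → C3) where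
  carrier := {X | AnalyticOnNhd ℂ X Ω ∧ ∀ p ∉ Ω, X p = 0}
  zero_mem' := ⟨analyticOnNhd_const, fun _ _ => rfl⟩
  add_mem' := fun {X Y} hX hY =>
    ⟨hX.1.add hY.1, fun p hp => by simp [hX.2 p hp, hY.2 p hp]⟩
  smul_mem' := fun c X hX =>
    ⟨fun p hp => by
      have h : AnalyticAt ℂ ((c : ℂ) • X) p := (hX.1 p hp).const_smul
      refine h.congr (Filter.Eventually.of_forall fun q => ?_)
      simp,
     fun p hp => by simp [hX.2 p hp]⟩

namespace HolVF

variable {Ω : Opens C3}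

theorem analyticAt_coe (X : HolVF Ω) {p : C3} (hp : p ∈ Ω) : AnalyticAt ℂ X.1 p := X.2.1 p hp

theorem differentiableAt_coe (X : HolVF Ω) {p : C3} (hp : p ∈ Ω) : DifferentiableAt ℂ X.1 p :=
  (analyticAt_coe X hp).differentiableAt

theorem ext_on {X Y : HolVF Ω} (h : ∀ p ∈ Ω, X.1 p = Y.1 p) : X = Y := by
  apply Subtype.ext
  funext p
  by_cases hp : p ∈ Ω
  · exact h p hp
  · rw [X.2.2 p hp, Y.2.2 p hp]

/-- A field given on `Ω` by a formula that is holomorphic on `Ω`. -/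
def mk (Ω : Opens C3) (X : C3 → C3) (hX : AnalyticOnNhd ℂ X Ω) : HolVF Ω :=
  ⟨(Ω : Set C3).indicator X,
    fun p hp => (hX p hp).congr (by
      filter_upwards [Ω.isOpen.mem_nhds hp] with q hq
      exact (Set.indicator_of_mem hq X).symm),
    fun _ hp => Set.indicator_of_notMem hp X⟩

theorem mk_apply {X : C3 → C3} {hX : AnalyticOnNhd ℂ X Ω} {p : C3} (hp : p ∈ Ω) :
    (mk Ω X hX).1 p = X p := Set.indicator_of_mem hp X

theorem mk_eventuallyEq {X : C3 → C3} {hX : AnalyticOnNhd ℂ X Ω} {p : C3} (hp : p ∈ Ω) :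
    (mk Ω X hX).1 =ᶠ[nhds p] X := by
  filter_upwards [Ω.isOpen.mem_nhds hp] with q hq
  exact mk_apply hq

theorem analyticOnNhd_lieBracket (X Y : HolVF Ω) :
    AnalyticOnNhd ℂ (VectorField.lieBracket ℂ X.1 Y.1) Ω := fun p hp => by
  have hX := (analyticAt_coe X hp).contDiffAt (n := ⊤)
  have hY := (analyticAt_coe Y hp).contDiffAt (n := ⊤)
  exact (hX.lieBracket_vectorField hY (m := ⊤) (by simp)).analyticAt

/-- The Lie bracket of vector fields. -/
instance : Bracket (HolVF Ω) (HolVF Ω) where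
  bracket X Y := mk Ω (VectorField.lieBracket ℂ X.1 Y.1) (analyticOnNhd_lieBracket X Y)

theorem bracket_apply (X Y : HolVF Ω) {p : C3} (hp : p ∈ Ω) :
    (⁅X, Y⁆ : HolVF Ω).1 p = VectorField.lieBracket ℂ X.1 Y.1 p := mk_apply hp

theorem bracket_eventuallyEq (X Y : HolVF Ω) {p : C3} (hp : p ∈ Ω) :
    (⁅X, Y⁆ : HolVF Ω).1 =ᶠ[nhds p] VectorField.lieBracket ℂ X.1 Y.1 := mk_eventuallyEq hp

instance : LieRing (HolVF Ω) where
  add_lie X Y Z := ext_on fun p hp => by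
    rw [bracket_apply _ _ hp, Submodule.coe_add, Submodule.coe_add, Pi.add_apply,
      bracket_apply _ _ hp, bracket_apply _ _ hp,
      VectorField.lieBracket_add_left (differentiableAt_coe X hp) (differentiableAt_coe Y hp)]
  lie_add X Y Z := ext_on fun p hp => by
    rw [bracket_apply _ _ hp, Submodule.coe_add, Submodule.coe_add, Pi.add_apply,
      bracket_apply _ _ hp, bracket_apply _ _ hp,
      VectorField.lieBracket_add_right (differentiableAt_coe Y hp) (differentiableAt_coe Z hp)]
  lie_self X := ext_on fun p hp => by
    rw [bracket_apply _ _ hp, VectorField.lieBracket_self]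
    rfl
  leibniz_lie X Y Z := ext_on fun p hp => by
    rw [bracket_apply _ _ hp, Submodule.coe_add, Pi.add_apply,
      bracket_apply _ _ hp, bracket_apply _ _ hp,
      (Filter.EventuallyEq.refl _ X.1).lieBracket_vectorField_eq (bracket_eventuallyEq Y Z hp),
      (bracket_eventuallyEq X Y hp).lieBracket_vectorField_eq (Filter.EventuallyEq.refl _ Z.1),
      (Filter.EventuallyEq.refl _ Y.1).lieBracket_vectorField_eq (bracket_eventuallyEq X Z hp)]
    exact VectorField.leibniz_identity_lieBracket (n := 2) (by simp)
      (analyticAt_coe X hp).contDiffAt (analyticAt_coe Y hp).contDiffAt (analyticAt_coe Z hp).contDiffAt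

instance : LieAlgebra ℝ (HolVF Ω) where
  lie_smul c X Y := ext_on fun p hp => by
    have hc : ((c • Y : HolVF Ω) : C3 → C3) = (c : ℂ) • Y.1 := by
      funext q
      simp
    rw [bracket_apply _ _ hp, hc, VectorField.lieBracket_const_smul_right (differentiableAt_coe Y hp),
      Submodule.coe_smul, Pi.smul_apply, bracket_apply _ _ hp]
    simp

end HolVF

/-- The open cylinder `U × ℂ_w` over an open set `U ⊆ ℂ²`. -/
def cylinder (U : Opens (ℂ × ℂ)) : Opens C3 :=
  ⟨(U : Set (ℂ × ℂ)) ×ˢ Set.univ, U.isOpen.prod isOpen_univ⟩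

/-- The rigid hypersurface `u = F(z₁, z₂, z̄₁, z̄₂)`, `w = u + i v`, over `U`. -/
def rigidHypersurface (U : Opens (ℂ × ℂ)) (F : ℂ × ℂ → ℝ) : Set C3 :=
  {p | p.1 ∈ U ∧ p.2.re = F p.1}

/-- The real tangent space at `p` of `u = F`: the kernel of the real differential of the defining
function `u - F`. -/
def tangentSpaceAt (F : ℂ × ℂ → ℝ) (p : C3) : Submodule ℝ C3 :=
  LinearMap.ker (fderiv ℝ (fun q : C3 => q.2.re - F q.1) p : C3 →L[ℝ] ℝ).toLinearMap

/-- The infinitesimal rigid biholomorphisms of `M = {u = F}` over `U`: holomorphic fields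
`X = A₁(z) ∂_{z₁} + A₂(z) ∂_{z₂} + (α w + B(z)) ∂_w` with `A₁, A₂, B` holomorphic on `U` and
`α` real, such that `X + X̄` is tangent to `M`. For a complex coefficient `a = a' + i a''` one has
`a ∂_z + ā ∂_{z̄} = a' ∂_x + a'' ∂_y`, so under `ℂ³ = ℝ⁶` the real vector `(X + X̄)(p)` is just
the coefficient vector `X p`. -/
def holRigid (U : Opens (ℂ × ℂ)) (F : ℂ × ℂ → ℝ) : Set (HolVF (cylinder U)) :=
  {X | (∃ (A₁ A₂ B : ℂ × ℂ → ℂ) (α : ℝ),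
          AnalyticOnNhd ℂ A₁ U ∧ AnalyticOnNhd ℂ A₂ U ∧ AnalyticOnNhd ℂ B U ∧
          ∀ p ∈ cylinder U, X.1 p = ((A₁ p.1, A₂ p.1), (α : ℂ) * p.2 + B p.1)) ∧
        ∀ p ∈ rigidHypersurface U F, X.1 p ∈ tangentSpaceAt F p}

/-- The right-hand side of the equation of the model, as a complex number. -/
def modelC (z : ℂ × ℂ) : ℂ :=
  (z.1 * conj z.1 + (1 / 2) * z.1 ^ 2 * conj z.2 + (1 / 2) * (conj z.1) ^ 2 * z.2) /
    (1 - z.2 * conj z.2)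

/-- The graphing function of the model. -/
def modelF (z : ℂ × ℂ) : ℝ := (modelC z).re

/-- The right-hand side is real, so that taking its real part loses nothing. -/
theorem modelF_eq (z : ℂ × ℂ) : (modelF z : ℂ) = modelC z := by
  refine Complex.conj_eq_iff_re.mp ?_
  simp only [modelC, map_div₀, map_add, map_sub, map_mul, map_pow, map_one, map_ofNat,
    Complex.conj_conj]
  congr 1 <;> ring

/-- The coefficients of the seven fields `X¹, …, X⁷` at `p = ((z₁, z₂), w)`. -/
def modelCoeff : Fin 7 → C3 → C3 := fun i p =>
  let z₁ := p.1.1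
  let z₂ := p.1.2
  let w := p.2
  let I := Complex.I
  ![((0, 0), I),
    ((z₁, 0), 2 * w),
    ((I * z₁, 2 * I * z₂), 0),
    ((z₂ - 1, 0), -2 * z₁),
    ((I + I * z₂, 0), -2 * I * z₁),
    ((z₁ * z₂, z₂ ^ 2 - 1), -z₁ ^ 2),
    ((I * z₁ * z₂, I * z₂ ^ 2 + I), -I * z₁ ^ 2)] i

theorem analyticOnNhd_modelCoeff (i : Fin 7) (s : Set C3) : AnalyticOnNhd ℂ (modelCoeff i) s := by
  have h : ContDiff ℂ ⊤ (modelCoeff i) := by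
    unfold modelCoeff
    fin_cases i <;> simp <;> fun_prop
  exact fun p _ => h.contDiffAt.analyticAt

/-- The seven fields `X¹, …, X⁷`, restricted to `U × ℂ_w`. -/
def modelField (U : Opens (ℂ × ℂ)) (i : Fin 7) : HolVF (cylinder U) :=
  HolVF.mk (cylinder U) (modelCoeff i) (analyticOnNhd_modelCoeff i _)

end RigidCR

end

/-!
Write `s = ∂F/∂z₁`, so that `conj s = z₁ + z₂ s` and `dF (v₁, v₂) = Re (2 s v₁ + s² v₂)`. With
`a = 2 A₁ - α z₁`, tangency of `X` becomes `Re (a s + A₂ s² - B) = 0`. The level sets of `s` are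
complex lines (the leaves of the Levi foliation), and along each of them the tangency equation says
that a holomorphic function has zero real part. Differentiating it there gives a cubic equation
for `s` with holomorphic coefficients. Since `s` is nowhere holomorphic, the coefficients vanish,
and the resulting linear system forces `a`, `A₂`, `B` to be quadratic polynomials; substituting
them back leaves exactly seven real parameters. Closure under brackets holds for every `C²` graphing
function `F`, by symmetry of its second derivative.
-/

namespace RigidCR

open scoped Topology

section HolomorphicFunctions

variable {E : Type*} [NormedAddCommGroup E] [NormedSpace ℂ E]

theorem fderiv_eq_zero_of_differentiableAt_conj {f : E → ℂ} {z : E} (hf : DifferentiableAt ℂ f z)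
    (hconj : DifferentiableAt ℂ (fun y => conj (f y)) z) : fderiv ℂ f z = 0 := by
  have hL := (Complex.conjCLE.hasFDerivAt.comp z (hf.hasFDerivAt.restrictScalars ℝ)).unique
    (hconj.hasFDerivAt.restrictScalars ℝ)
  ext v
  have hv : conj (fderiv ℂ f z v) = fderiv ℂ (fun y => conj (f y)) z v := congr($hL v)
  have hIv : conj (fderiv ℂ f z (Complex.I • v)) =
    fderiv ℂ (fun y => conj (f y)) z (Complex.I • v) := congr($hL (Complex.I • v))
  simp only [map_smul, ← hv, smul_eq_mul, map_mul, Complex.conj_I] at hIv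
  have hzero : conj (fderiv ℂ f z v) = 0 := by
    linear_combination (Complex.I / 2) * hIv + conj (fderiv ℂ f z v) * Complex.I_sq
  simpa using hzero

theorem fderiv_eq_zero_of_re_eventuallyEq_zero {f : E → ℂ} {z : E} (hf : DifferentiableAt ℂ f z)
    (hre : ∀ᶠ y in 𝓝 z, (f y).re = 0) : fderiv ℂ f z = 0 := by
  refine fderiv_eq_zero_of_differentiableAt_conj hf (hf.neg.congr_of_eventuallyEq ?_)
  filter_upwards [hre] with y hy
  exact Complex.ext (by simp [hy]) (by simp)

theorem analyticOnNhd_fderiv_apply [CompleteSpace E] {f : E → ℂ} {v : E → E} {s : Set E}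
    (hf : AnalyticOnNhd ℂ f s) (hv : AnalyticOnNhd ℂ v s) :
    AnalyticOnNhd ℂ (fun z => fderiv ℂ f z (v z)) s := fun z hz =>
  ((hf.fderiv z hz).contDiffAt.clm_apply (hv z hz).contDiffAt (n := ⊤)).analyticAt

theorem hasFDerivAt_sum_mul_pow {n : ℕ} {c : Fin n → E → ℂ} {s : E → ℂ}
    {c' : Fin n → E →L[ℂ] ℂ} {s' : E →L[ℝ] ℂ} {z : E} (hc : ∀ j, HasFDerivAt (c j) (c' j) z)
    (hs : HasFDerivAt s s' z) :
    HasFDerivAt (fun y => ∑ j, c j y * s y ^ (j : ℕ))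
      ((∑ j : Fin n, s z ^ (j : ℕ) • c' j).restrictScalars ℝ +
        (∑ j : Fin n, j * c j z * s z ^ (j - 1 : ℕ)) • s') z := by
  refine (HasFDerivAt.fun_sum fun j _ =>
    ((hc j).restrictScalars ℝ).mul (hs.pow (j : ℕ))).congr_fderiv ?_
  ext v
  simp only [nsmul_eq_mul, sum_apply, add_apply,
    smul_apply, ContinuousLinearMap.coe_restrictScalars', smul_eq_mul,
    Finset.sum_mul, ← Finset.sum_add_distrib]
  exact Finset.sum_congr rfl fun j _ => by ring

theorem sum_mul_pow_pred_eq_zero {n : ℕ} {c : Fin n → E → ℂ} {s : E → ℂ} {z : E}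
    (hc : ∀ j, DifferentiableAt ℂ (c j) z) (hs : DifferentiableAt ℝ s z)
    (hs' : ¬DifferentiableAt ℂ s z) (h : ∀ᶠ y in 𝓝 z, ∑ j, c j y * s y ^ (j : ℕ) = 0) :
    ∑ j : Fin n, j * c j z * s z ^ (j - 1 : ℕ) = 0 := by
  set L : E →L[ℂ] ℂ := ∑ j : Fin n, s z ^ (j : ℕ) • fderiv ℂ (c j) z
  set μ := ∑ j : Fin n, j * c j z * s z ^ (j - 1 : ℕ)
  have hsum : L.restrictScalars ℝ + μ • fderiv ℝ s z = 0 :=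
    (hasFDerivAt_sum_mul_pow (fun j => (hc j).hasFDerivAt) hs.hasFDerivAt).unique
      ((hasFDerivAt_const 0 z).congr_of_eventuallyEq h)
  by_contra hμ
  refine hs' (hasFDerivAt_of_restrictScalars ℝ (f' := -μ⁻¹ • L) hs.hasFDerivAt ?_).differentiableAt
  ext v
  have hv : L v + μ * fderiv ℝ s z v = 0 := congr($hsum v)
  simp only [ContinuousLinearMap.coe_restrictScalars',
    smul_apply, smul_eq_mul]
  field_simp
  linear_combination -hv

theorem coeff_eq_zero_of_sum_mul_pow_eq_zero {U : Set E} (hU : IsOpen U) {s : E → ℂ}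
    (hs : ∀ z ∈ U, DifferentiableAt ℝ s z) (hs' : ∀ z ∈ U, ¬DifferentiableAt ℂ s z)
    {n : ℕ} {c : Fin n → E → ℂ} (hc : ∀ j, DifferentiableOn ℂ (c j) U)
    (h : ∀ z ∈ U, ∑ j, c j z * s z ^ (j : ℕ) = 0) : ∀ j, ∀ z ∈ U, c j z = 0 := by
  induction n with
  | zero => exact fun j => j.elim0
  | succ n ih =>
    have hderiv : ∀ z ∈ U, ∑ j : Fin n, (j + 1 : ℂ) * c j.succ z * s z ^ (j : ℕ) = 0 := by
      intro z hz
      have hUz := hU.mem_nhds hz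
      simpa [Fin.sum_univ_succ] using
        sum_mul_pow_pred_eq_zero (fun j => (hc j).differentiableAt hUz) (hs z hz) (hs' z hz)
          (Filter.eventually_of_mem hUz h)
    have hsucc : ∀ j : Fin n, ∀ z ∈ U, c j.succ z = 0 := fun j z hz =>
      (mul_eq_zero.1 (ih (fun j => (hc j.succ).const_mul _) hderiv j z hz)).resolve_left
        (Nat.cast_add_one_ne_zero (j : ℕ))
    refine Fin.cases (fun z hz => ?_) hsucc
    simpa [Fin.sum_univ_succ, hsucc _ z hz] using h z hz

theorem not_differentiableAt_conj_clm {ℓ : E →L[ℂ] ℂ} (hℓ : ℓ ≠ 0) (z : E) :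
    ¬DifferentiableAt ℂ (fun y => conj (ℓ y)) z := fun h =>
  hℓ (ℓ.fderiv.symm.trans (fderiv_eq_zero_of_differentiableAt_conj ℓ.differentiableAt h))

theorem coeff_eq_zero_of_sum_mul_pow_clm_eq_zero {ℓ : E →L[ℂ] ℂ} (hℓ : ℓ ≠ 0) {U : Set E}
    (hU : IsOpen U) (hne : U.Nonempty) {n : ℕ} {c : Fin n → ℂ}
    (h : ∀ z ∈ U, ∑ j, c j * ℓ z ^ (j : ℕ) = 0) (j : Fin n) : c j = 0 := by
  obtain ⟨z, hz⟩ := hne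
  have := coeff_eq_zero_of_sum_mul_pow_eq_zero hU (s := fun y => conj (ℓ y))
    (c := fun j _ => conj (c j)) (fun z _ =>
      (Complex.conjCLE.differentiableAt.comp z (ℓ.restrictScalars ℝ).differentiableAt))
    (fun z _ => not_differentiableAt_conj_clm hℓ z) (fun _ => differentiableOn_const _)
    (fun z hz => by simpa using congr(conj $(h z hz))) j z hz
  simpa using this

theorem coeff_eq_zero_of_re_quadratic_eq_zero {V : Set ℂ} (hV : IsOpen V) (hne : V.Nonempty)
    {b n c m : ℂ}
    (h : ∀ σ ∈ V, (b + n * σ + c * (σ * conj σ) + m * σ ^ 2).re = 0) :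
    b.re = 0 ∧ n = 0 ∧ c.re = 0 ∧ m = 0 := by
  have hid : ContinuousLinearMap.id ℂ ℂ ≠ 0 := fun h => one_ne_zero (α := ℂ) congr($h 1)
  have hcoeff := coeff_eq_zero_of_sum_mul_pow_eq_zero hV (s := fun σ => conj σ)
    (c := ![fun σ => (b + conj b) + n * σ + m * σ ^ 2, fun σ => conj n + (c + conj c) * σ,
      fun _ => conj m])
    (fun σ _ => Complex.conjCLE.differentiableAt)
    (fun σ _ => not_differentiableAt_conj_clm hid σ)
    (Fin.forall_fin_succ.2 ⟨by simp only [Matrix.cons_val_zero]; fun_prop, Fin.forall_fin_two.2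
      ⟨(differentiableOn_id.const_mul _).const_add _, differentiableOn_const _⟩⟩)
    (fun σ hσ => by
      have hre := Complex.add_conj (b + n * σ + c * (σ * conj σ) + m * σ ^ 2)
      simp only [h σ hσ, mul_zero, Complex.ofReal_zero, map_add, map_mul, map_pow,
        Complex.conj_conj] at hre
      have hpoly : (b + conj b + n * σ + m * σ ^ 2) + (conj n + (c + conj c) * σ) * conj σ +
          conj m * conj σ ^ 2 = 0 := by linear_combination hre
      simpa [Fin.sum_univ_three] using hpoly)
  have hm : m = 0 := (map_eq_zero _).1 (hcoeff 2 _ hne.some_mem)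
  have hlin := coeff_eq_zero_of_sum_mul_pow_clm_eq_zero hid hV hne
    (c := ![conj n, c + conj c]) (fun σ hσ => by simpa using hcoeff 1 σ hσ)
  have hn : n = 0 := (map_eq_zero _).1 (hlin 0)
  have re_eq_zero {x : ℂ} (hx : x + conj x = 0) : x.re = 0 := by
    simpa [Complex.add_conj] using hx
  exact ⟨re_eq_zero (by simpa [hn, hm] using hcoeff 0 _ hne.some_mem), hn,
    re_eq_zero (hlin 1), hm⟩

end HolomorphicFunctions

section RigidSymmetries

variable {U : Opens (ℂ × ℂ)} {F : ℂ × ℂ → ℝ} {A A' : ℂ × ℂ → ℂ × ℂ} {B B' : ℂ × ℂ → ℂ}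
  {α α' : ℝ} {z : ℂ × ℂ}

/-- The rigid vector field `A₁ ∂_{z₁} + A₂ ∂_{z₂} + (α w + B) ∂_w` with `A = (A₁, A₂)`. -/
def rigidField (A : ℂ × ℂ → ℂ × ℂ) (α : ℝ) (B : ℂ × ℂ → ℂ) : C3 → C3 :=
  fun p => (A p.1, α * p.2 + B p.1)

/-- `rigidField A α B` is an infinitesimal rigid biholomorphism of `{u = F}` over `U`. Since `F`
does not depend on `v`, tangency is an equation on the base `U`. -/
structure IsRigidSymmetry (U : Opens (ℂ × ℂ)) (F : ℂ × ℂ → ℝ) (A : ℂ × ℂ → ℂ × ℂ) (α : ℝ)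
    (B : ℂ × ℂ → ℂ) : Prop where
  analyticOnNhd_left : AnalyticOnNhd ℂ A U
  analyticOnNhd_right : AnalyticOnNhd ℂ B U
  fderiv_apply : ∀ z ∈ U, fderiv ℝ F z (A z) = α * F z + (B z).re

theorem mem_tangentSpaceAt_iff {p v : C3} (hF : DifferentiableAt ℝ F p.1) :
    v ∈ tangentSpaceAt F p ↔ fderiv ℝ F p.1 v.1 = v.2.re := by
  have hu : HasFDerivAt (fun q : C3 => q.2.re)
      (Complex.reCLM ∘L ContinuousLinearMap.snd ℝ (ℂ × ℂ) ℂ) p :=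
    (Complex.reCLM ∘L ContinuousLinearMap.snd ℝ (ℂ × ℂ) ℂ).hasFDerivAt
  have h := (hu.fun_sub (hF.hasFDerivAt.comp p hasFDerivAt_fst)).fderiv
  rw [tangentSpaceAt, LinearMap.mem_ker]
  exact (congr($h v = 0)).to_iff.trans (sub_eq_zero.trans eq_comm)

theorem mem_holRigid_iff (hF : DifferentiableOn ℝ F U) {X : HolVF (cylinder U)} :
    X ∈ holRigid U F ↔
      ∃ A α B, IsRigidSymmetry U F A α B ∧ Set.EqOn X.1 (rigidField A α B) (cylinder U) := by
  have htan {A : ℂ × ℂ → ℂ × ℂ} {α : ℝ} {B : ℂ × ℂ → ℂ}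
      (hX : Set.EqOn X.1 (rigidField A α B) (cylinder U)) {p : C3}
      (hp : p ∈ rigidHypersurface U F) :
      X.1 p ∈ tangentSpaceAt F p ↔ fderiv ℝ F p.1 (A p.1) = α * F p.1 + (B p.1).re := by
    rw [mem_tangentSpaceAt_iff (hF.differentiableAt (U.isOpen.mem_nhds hp.1)),
      hX ⟨hp.1, trivial⟩, ← hp.2]
    simp [rigidField]
  constructor
  · rintro ⟨⟨A₁, A₂, B, α, hA₁, hA₂, hB, hX⟩, hT⟩
    refine ⟨fun z => (A₁ z, A₂ z), α, B, ⟨hA₁.prod hA₂, hB, fun z hz => ?_⟩, hX⟩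
    have hp : (z, (F z : ℂ)) ∈ rigidHypersurface U F := ⟨hz, Complex.ofReal_re _⟩
    exact (htan (A := fun z => (A₁ z, A₂ z)) (α := α) (B := B) hX hp).1 (hT _ hp)
  · rintro ⟨A, α, B, hA, hX⟩
    exact ⟨⟨fun z => (A z).1, fun z => (A z).2, B, α,
      fun z hz => analyticAt_fst.comp (hA.analyticOnNhd_left z hz),
      fun z hz => analyticAt_snd.comp (hA.analyticOnNhd_left z hz),
      hA.analyticOnNhd_right, hX⟩,
      fun p hp => (htan hX hp).2 (hA.fderiv_apply p.1 hp.1)⟩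

theorem lieBracket_rigidField {p : C3} (hA : DifferentiableAt ℂ A p.1)
    (hA' : DifferentiableAt ℂ A' p.1) (hB : DifferentiableAt ℂ B p.1)
    (hB' : DifferentiableAt ℂ B' p.1) :
    VectorField.lieBracket ℂ (rigidField A α B) (rigidField A' α' B') p =
      rigidField (VectorField.lieBracket ℂ A A') 0
        (fun z => fderiv ℂ B' z (A z) - fderiv ℂ B z (A' z) + α' * B z - α * B' z) p := by
  have hderiv {A : ℂ × ℂ → ℂ × ℂ} {α : ℝ} {B : ℂ × ℂ → ℂ}
      (hA : DifferentiableAt ℂ A p.1) (hB : DifferentiableAt ℂ B p.1) (v : C3) :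
      fderiv ℂ (rigidField A α B) p v =
        (fderiv ℂ A p.1 v.1, α * v.2 + fderiv ℂ B p.1 v.1) := by
    have h := ((hA.hasFDerivAt.comp p hasFDerivAt_fst).prodMk
      ((hasFDerivAt_snd.const_mul (α : ℂ)).add (hB.hasFDerivAt.comp p hasFDerivAt_fst))).fderiv
    exact congr($h v)
  rw [VectorField.lieBracket, hderiv hA' hB', hderiv hA hB]
  refine Prod.ext rfl ?_
  simp only [rigidField, Prod.snd_sub, Complex.ofReal_zero]
  ring

namespace IsRigidSymmetry

theorem zero : IsRigidSymmetry U F 0 0 0 :=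
  ⟨analyticOnNhd_const, analyticOnNhd_const, fun z _ => by simp⟩

theorem add (h : IsRigidSymmetry U F A α B) (h' : IsRigidSymmetry U F A' α' B') :
    IsRigidSymmetry U F (A + A') (α + α') (B + B') where
  analyticOnNhd_left := h.analyticOnNhd_left.add h'.analyticOnNhd_left
  analyticOnNhd_right := h.analyticOnNhd_right.add h'.analyticOnNhd_right
  fderiv_apply z hz := by
    simp only [Pi.add_apply, map_add, h.fderiv_apply z hz, h'.fderiv_apply z hz, Complex.add_re]
    ring

theorem smul (c : ℝ) (h : IsRigidSymmetry U F A α B) :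
    IsRigidSymmetry U F ((c : ℂ) • A) (c * α) ((c : ℂ) • B) where
  analyticOnNhd_left _ hz := (h.analyticOnNhd_left _ hz).const_smul
  analyticOnNhd_right _ hz := (h.analyticOnNhd_right _ hz).const_smul
  fderiv_apply z hz := by
    simp only [Pi.smul_apply, Complex.coe_smul, map_smul, h.fderiv_apply z hz, smul_eq_mul,
      Complex.re_ofReal_mul]
    ring

theorem fderiv_fderiv_apply (h : IsRigidSymmetry U F A α B) (hF : ContDiffOn ℝ 2 F U) (hz : z ∈ U)
    (v : ℂ × ℂ) :
    fderiv ℝ (fderiv ℝ F) z v (A z) + fderiv ℝ F z (fderiv ℂ A z v) =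
      α * fderiv ℝ F z v + (fderiv ℂ B z v).re := by
  have hUz := U.isOpen.mem_nhds hz
  have hFz : ContDiffAt ℝ 2 F z := hF.contDiffAt hUz
  have hA := (h.analyticOnNhd_left z hz).differentiableAt.hasFDerivAt.restrictScalars ℝ
  have hB := (h.analyticOnNhd_right z hz).differentiableAt.hasFDerivAt.restrictScalars ℝ
  have hdF : DifferentiableAt ℝ (fderiv ℝ F) z :=
    (hFz.fderiv_right (m := 1) le_rfl).differentiableAt one_ne_zero
  have hleft := hdF.hasFDerivAt.clm_apply hA
  have hright := ((hFz.differentiableAt two_ne_zero).hasFDerivAt.const_mul α).add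
    (Complex.reCLM.hasFDerivAt.comp z hB)
  have heq := hleft.unique (hright.congr_of_eventuallyEq
    (Filter.eventually_of_mem hUz h.fderiv_apply))
  simpa [add_comm] using congr($heq v)

theorem lie (h : IsRigidSymmetry U F A α B) (h' : IsRigidSymmetry U F A' α' B')
    (hF : ContDiffOn ℝ 2 F U) :
    IsRigidSymmetry U F (VectorField.lieBracket ℂ A A') 0
      (fun z => fderiv ℂ B' z (A z) - fderiv ℂ B z (A' z) + α' * B z - α * B' z) where
  analyticOnNhd_left z hz :=
    ((h.analyticOnNhd_left z hz).contDiffAt.lieBracket_vectorField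
      (h'.analyticOnNhd_left z hz).contDiffAt (n := ⊤) (m := ⊤) (by simp)).analyticAt
  analyticOnNhd_right := by
    have hB := h.analyticOnNhd_right
    have hB' := h'.analyticOnNhd_right
    exact (((analyticOnNhd_fderiv_apply hB' h.analyticOnNhd_left).sub
      (analyticOnNhd_fderiv_apply hB h'.analyticOnNhd_left)).add
      (analyticOnNhd_const.mul hB)).sub (analyticOnNhd_const.mul hB')
  fderiv_apply z hz := by
    have hsymm : fderiv ℝ (fderiv ℝ F) z (A z) (A' z) = fderiv ℝ (fderiv ℝ F) z (A' z) (A z) :=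
      (hF.contDiffAt (U.isOpen.mem_nhds hz)).isSymmSndFDerivAt (by simp) _ _
    have hd := h.fderiv_fderiv_apply hF hz (A' z)
    have hd' := h'.fderiv_fderiv_apply hF hz (A z)
    simp only [h.fderiv_apply z hz, h'.fderiv_apply z hz] at hd hd'
    simp only [VectorField.lieBracket, map_sub, Complex.sub_re, Complex.add_re,
      Complex.re_ofReal_mul]
    linear_combination hd' - hd - hsymm

end IsRigidSymmetry

/-- The infinitesimal rigid biholomorphisms of a `C²` rigid hypersurface, as a real Lie algebra. -/
def holRigidLieSubalgebra (U : Opens (ℂ × ℂ)) (F : ℂ × ℂ → ℝ) (hF : ContDiffOn ℝ 2 F U) :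
    LieSubalgebra ℝ (HolVF (cylinder U)) where
  carrier := holRigid U F
  zero_mem' := (mem_holRigid_iff (hF.differentiableOn two_ne_zero)).2
    ⟨0, 0, 0, .zero, fun p _ => Prod.ext rfl (by simp [rigidField])⟩
  add_mem' := by
    simp only [mem_holRigid_iff (hF.differentiableOn two_ne_zero)]
    rintro X Y ⟨A, α, B, hA, hX⟩ ⟨A', α', B', hA', hY⟩
    refine ⟨_, _, _, hA.add hA', fun p hp => ?_⟩
    rw [Submodule.coe_add, Pi.add_apply, hX hp, hY hp]
    refine Prod.ext rfl ?_
    simp only [rigidField, Prod.snd_add, Pi.add_apply, Complex.ofReal_add]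
    ring
  smul_mem' := by
    simp only [mem_holRigid_iff (hF.differentiableOn two_ne_zero)]
    rintro c X ⟨A, α, B, hA, hX⟩
    refine ⟨_, _, _, hA.smul c, fun p hp => ?_⟩
    rw [Submodule.coe_smul, Pi.smul_apply, hX hp]
    refine Prod.ext (by simp [rigidField]) ?_
    simp [rigidField, mul_assoc]
  lie_mem' := by
    simp only [mem_holRigid_iff (hF.differentiableOn two_ne_zero)]
    rintro X Y ⟨A, α, B, hA, hX⟩ ⟨A', α', B', hA', hY⟩
    refine ⟨_, _, _, hA.lie hA' hF, fun p hp => ?_⟩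
    have hUp := (cylinder U).isOpen.mem_nhds hp
    rw [HolVF.bracket_apply X Y hp, (hX.eventuallyEq_of_mem hUp).lieBracket_vectorField_eq
      (hY.eventuallyEq_of_mem hUp)]
    exact lieBracket_rigidField (hA.analyticOnNhd_left _ hp.1).differentiableAt
      (hA'.analyticOnNhd_left _ hp.1).differentiableAt
      (hA.analyticOnNhd_right _ hp.1).differentiableAt
      (hA'.analyticOnNhd_right _ hp.1).differentiableAt

end RigidSymmetries

section Slope

variable {z : ℂ × ℂ}

/-- The derivative `∂F/∂z₁` of the graphing function `F` of the model. -/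
noncomputable def slope (z : ℂ × ℂ) : ℂ := (conj z.1 + z.1 * conj z.2) / (1 - z.2 * conj z.2)

theorem conj_slope (hz : 1 - z.2 * conj z.2 ≠ 0) : conj (slope z) = z.1 + z.2 * slope z := by
  simp only [slope, map_div₀, map_add, map_sub, map_mul, map_one, Complex.conj_conj]
  rw [mul_comm (conj z.2) z.2]
  field_simp
  ring

theorem slope_conj_sub_mul {σ z₂ : ℂ} (hz : 1 - z₂ * conj z₂ ≠ 0) :
    slope (conj σ - z₂ * σ, z₂) = σ := by
  simp only [slope, map_sub, map_mul, Complex.conj_conj]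
  rw [div_eq_iff hz]
  ring

theorem modelF_eq_re (hz : 1 - z.2 * conj z.2 ≠ 0) : modelF z = (z.1 * slope z).re := by
  have hz' : 1 - conj z.2 * z.2 ≠ 0 := by rwa [mul_comm]
  have h : modelC z = (z.1 * slope z + conj (z.1 * slope z)) / 2 := by
    rw [map_mul, conj_slope hz]
    simp only [modelC, slope]
    field_simp
    ring
  rw [modelF, h, Complex.add_conj, Complex.div_ofNat_re, Complex.ofReal_re,
    mul_div_cancel_left₀ _ two_ne_zero]

theorem eventually_one_sub_mul_conj_ne_zero (hz : 1 - z.2 * conj z.2 ≠ 0) :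
    ∀ᶠ y : ℂ × ℂ in 𝓝 z, 1 - y.2 * conj y.2 ≠ 0 :=
  ContinuousAt.eventually_ne (by fun_prop) hz

theorem contDiffAt_slope (hz : 1 - z.2 * conj z.2 ≠ 0) : ContDiffAt ℝ 2 slope z := by
  have hconj₁ : ContDiffAt ℝ 2 (fun y : ℂ × ℂ => conj y.1) z :=
    Complex.conjCLE.contDiff.contDiffAt.comp z contDiffAt_fst
  have hconj₂ : ContDiffAt ℝ 2 (fun y : ℂ × ℂ => conj y.2) z :=
    Complex.conjCLE.contDiff.contDiffAt.comp z contDiffAt_snd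
  exact (hconj₁.add (contDiffAt_fst.mul hconj₂)).mul
    ((contDiffAt_const.sub (contDiffAt_snd.mul hconj₂)).inv hz)

theorem contDiffAt_modelF (hz : 1 - z.2 * conj z.2 ≠ 0) : ContDiffAt ℝ 2 modelF z :=
  (Complex.reCLM.contDiff.contDiffAt.comp z
    (contDiffAt_fst.mul (contDiffAt_slope hz))).congr_of_eventuallyEq
    ((eventually_one_sub_mul_conj_ne_zero hz).mono fun _ => modelF_eq_re)

theorem conj_fderiv_slope (hz : 1 - z.2 * conj z.2 ≠ 0) (v : ℂ × ℂ) :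
    conj (fderiv ℝ slope z v) = v.1 + v.2 * slope z + z.2 * fderiv ℝ slope z v := by
  have hs := ((contDiffAt_slope hz).differentiableAt two_ne_zero).hasFDerivAt
  have hleft := Complex.conjCLE.hasFDerivAt.comp z hs
  have hright := (hasFDerivAt_fst (𝕜 := ℝ) (p := z)).add ((hasFDerivAt_snd (𝕜 := ℝ)).mul hs)
  have heq := hleft.unique (hright.congr_of_eventuallyEq
    ((eventually_one_sub_mul_conj_ne_zero hz).mono fun _ => conj_slope))
  refine (congr($heq v)).trans ?_
  simp only [add_apply, smul_apply, ContinuousLinearMap.coe_fst', ContinuousLinearMap.coe_snd',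
    smul_eq_mul]
  ring

theorem fderiv_modelF (hz : 1 - z.2 * conj z.2 ≠ 0) (v : ℂ × ℂ) :
    fderiv ℝ modelF z v = (2 * slope z * v.1 + slope z ^ 2 * v.2).re := by
  have hs := ((contDiffAt_slope hz).differentiableAt two_ne_zero).hasFDerivAt
  have hF := (Complex.reCLM.hasFDerivAt.comp z
    ((hasFDerivAt_fst (𝕜 := ℝ)).mul hs)).congr_of_eventuallyEq
    ((eventually_one_sub_mul_conj_ne_zero hz).mono fun _ => modelF_eq_re)
  have hFv : fderiv ℝ modelF z v = (z.1 * fderiv ℝ slope z v + slope z * v.1).re :=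
    congr($hF.fderiv v)
  have hsplit : z.1 * fderiv ℝ slope z v + slope z * v.1 =
      2 * slope z * v.1 + slope z ^ 2 * v.2 +
        (conj (slope z) * fderiv ℝ slope z v - conj (conj (slope z) * fderiv ℝ slope z v)) := by
    rw [map_mul, Complex.conj_conj, conj_fderiv_slope hz, conj_slope hz]
    ring
  rw [hFv, hsplit, Complex.add_re, Complex.sub_re, Complex.conj_re, sub_self, add_zero]

theorem not_differentiableAt_slope (hz : 1 - z.2 * conj z.2 ≠ 0) :
    ¬DifferentiableAt ℂ slope z := by
  intro hs
  have hconj : DifferentiableAt ℂ (fun y => conj (slope y)) z :=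
    (differentiableAt_fst.add (differentiableAt_snd.mul hs)).congr_of_eventuallyEq
      ((eventually_one_sub_mul_conj_ne_zero hz).mono fun _ => conj_slope)
  have hzero : fderiv ℝ slope z = 0 := by
    rw [hs.fderiv_restrictScalars ℝ, fderiv_eq_zero_of_differentiableAt_conj hs hconj]
    rfl
  simpa [hzero] using conj_fderiv_slope hz (1, 0)

end Slope

section TangencyEquation

variable {U : Opens (ℂ × ℂ)} {a A B : ℂ × ℂ → ℂ} {z : ℂ × ℂ}

/-- The differential system on holomorphic `a`, `A`, `B` that results from differentiating the
tangency equation `Re (a s + A s² - B) = 0`, `s = ∂F/∂z₁`, along the Levi kernel. -/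
structure IsLeviSolution (U : Opens (ℂ × ℂ)) (a A B : ℂ × ℂ → ℂ) : Prop where
  fderiv_B_snd : ∀ z ∈ U, fderiv ℂ B z (0, 1) = 0
  fderiv_a_snd : ∀ z ∈ U, fderiv ℂ a z (0, 1) = -fderiv ℂ B z (1, 0)
  fderiv_A_snd : ∀ z ∈ U, fderiv ℂ A z (0, 1) = fderiv ℂ a z (1, 0)
  fderiv_A_fst : ∀ z ∈ U, fderiv ℂ A z (1, 0) = 0

theorem fderiv_apply_eq_add (f : ℂ × ℂ → ℂ) (z v : ℂ × ℂ) :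
    fderiv ℂ f z v = v.1 * fderiv ℂ f z (1, 0) + v.2 * fderiv ℂ f z (0, 1) := by
  rw [← smul_eq_mul, ← smul_eq_mul, ← map_smul, ← map_smul, ← map_add]
  simp

/-- The slope is constant along the complex line through `z` in the direction `(-slope z, 1)`, which
spans the Levi kernel, so there the tangency equation says that a holomorphic function has zero
real part. -/
theorem levi_kernel_equation (hdom : ∀ z ∈ U, 1 - z.2 * conj z.2 ≠ 0)
    (ha : DifferentiableOn ℂ a U) (hA : DifferentiableOn ℂ A U) (hB : DifferentiableOn ℂ B U)
    (htan : ∀ z ∈ U, (a z * slope z + A z * slope z ^ 2 - B z).re = 0) (hz : z ∈ U) :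
    fderiv ℂ a z (-slope z, 1) * slope z + fderiv ℂ A z (-slope z, 1) * slope z ^ 2 -
      fderiv ℂ B z (-slope z, 1) = 0 := by
  set s := slope z
  have hUz := U.isOpen.mem_nhds hz
  set γ : ℂ → ℂ × ℂ := fun ζ => (conj s - ζ * s, ζ)
  have hγz : γ z.2 = z := by simp [γ, s, conj_slope (hdom z hz)]
  have hγ : HasDerivAt γ (-s, 1) z.2 := by
    simpa using (((hasDerivAt_id z.2).mul_const s).const_sub (conj s)).prodMk (hasDerivAt_id z.2)
  have hcomp {f : ℂ × ℂ → ℂ} (hf : DifferentiableOn ℂ f U) :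
      HasDerivAt (fun ζ => f (γ ζ)) (fderiv ℂ f z (-s, 1)) z.2 :=
    (hf.differentiableAt hUz).hasFDerivAt.comp_hasDerivAt_of_eq z.2 hγ hγz.symm
  have hg := (((hcomp ha).mul_const s).add ((hcomp hA).mul_const (s ^ 2))).sub (hcomp hB)
  have hre : ∀ᶠ ζ in 𝓝 z.2, (a (γ ζ) * s + A (γ ζ) * s ^ 2 - B (γ ζ)).re = 0 := by
    filter_upwards [hγ.continuousAt.eventually_mem (hγz.symm ▸ hUz)] with ζ hζ
    simpa [γ, slope_conj_sub_mul (hdom _ hζ)] using htan _ hζ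
  rw [← hg.deriv, ← fderiv_apply_one_eq_deriv,
    fderiv_eq_zero_of_re_eventuallyEq_zero hg.differentiableAt hre, zero_apply]

theorem isLeviSolution_of_tangency (hdom : ∀ z ∈ U, 1 - z.2 * conj z.2 ≠ 0)
    (ha : AnalyticOnNhd ℂ a U) (hA : AnalyticOnNhd ℂ A U) (hB : AnalyticOnNhd ℂ B U)
    (htan : ∀ z ∈ U, (a z * slope z + A z * slope z ^ 2 - B z).re = 0) :
    IsLeviSolution U a A B := by
  have hpartial {f : ℂ × ℂ → ℂ} (hf : AnalyticOnNhd ℂ f U) (v : ℂ × ℂ) :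
      DifferentiableOn ℂ (fun z => fderiv ℂ f z v) U :=
    (analyticOnNhd_fderiv_apply hf analyticOnNhd_const).differentiableOn
  have hcoeff := coeff_eq_zero_of_sum_mul_pow_eq_zero U.isOpen (s := slope)
    (c := ![fun z => -fderiv ℂ B z (0, 1), fun z => fderiv ℂ a z (0, 1) + fderiv ℂ B z (1, 0),
      fun z => fderiv ℂ A z (0, 1) - fderiv ℂ a z (1, 0), fun z => -fderiv ℂ A z (1, 0)])
    (fun z hz => (contDiffAt_slope (hdom z hz)).differentiableAt two_ne_zero)
    (fun z hz => not_differentiableAt_slope (hdom z hz))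
    (Fin.forall_fin_succ.2 ⟨(hpartial hB _).neg, Fin.forall_fin_succ.2
      ⟨(hpartial ha _).add (hpartial hB _), Fin.forall_fin_succ.2
      ⟨(hpartial hA _).sub (hpartial ha _), Fin.forall_fin_one.2 (hpartial hA _).neg⟩⟩⟩)
    (fun z hz => by
      have h := levi_kernel_equation hdom ha.differentiableOn hA.differentiableOn
        hB.differentiableOn htan hz
      rw [fderiv_apply_eq_add a, fderiv_apply_eq_add A, fderiv_apply_eq_add B] at h
      have hcubic : -fderiv ℂ B z (0, 1) +
          (fderiv ℂ a z (0, 1) + fderiv ℂ B z (1, 0)) * slope z +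
          (fderiv ℂ A z (0, 1) - fderiv ℂ a z (1, 0)) * slope z ^ 2 +
          -fderiv ℂ A z (1, 0) * slope z ^ 3 = 0 := by
        linear_combination h
      simpa [Fin.sum_univ_four] using hcubic)
  exact ⟨fun z hz => neg_eq_zero.1 (hcoeff 0 z hz),
    fun z hz => eq_neg_of_add_eq_zero_left (hcoeff 1 z hz),
    fun z hz => sub_eq_zero.1 (hcoeff 2 z hz), fun z hz => neg_eq_zero.1 (hcoeff 3 z hz)⟩

end TangencyEquation

section Integration

variable {U : Opens (ℂ × ℂ)} {f a A B : ℂ × ℂ → ℂ} {z : ℂ × ℂ}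

theorem fderiv_fderiv_comm (hf : AnalyticAt ℂ f z) (v w : ℂ × ℂ) :
    fderiv ℂ (fun y => fderiv ℂ f y v) z w = fderiv ℂ (fun y => fderiv ℂ f y w) z v := by
  have hd : DifferentiableAt ℂ (fderiv ℂ f) z := hf.fderiv.differentiableAt
  have hsymm := (hf.contDiffAt (n := ⊤)).isSymmSndFDerivAt_of_omega
  simpa [fderiv_clm_apply hd] using hsymm w v

theorem fderiv_eq_of_eqOn {g : ℂ × ℂ → ℂ} (h : Set.EqOn f g U) (hz : z ∈ U) :
    fderiv ℂ f z = fderiv ℂ g z :=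
  (h.eventuallyEq_of_mem (U.isOpen.mem_nhds hz)).fderiv_eq

theorem fderiv_quadratic (c₁ c₂ c₁₁ c₁₂ c₂₂ : ℂ) (z v : ℂ × ℂ) :
    fderiv ℂ (fun y : ℂ × ℂ =>
      c₁ * y.1 + c₂ * y.2 + c₁₁ * y.1 ^ 2 + c₁₂ * (y.1 * y.2) + c₂₂ * y.2 ^ 2) z v =
      (c₁ + 2 * c₁₁ * z.1 + c₁₂ * z.2) * v.1 + (c₂ + c₁₂ * z.1 + 2 * c₂₂ * z.2) * v.2 := by
  have h₁ := hasFDerivAt_fst (𝕜 := ℂ) (p := z)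
  have h₂ := hasFDerivAt_snd (𝕜 := ℂ) (p := z)
  have h := ((((h₁.const_mul c₁).add (h₂.const_mul c₂)).add ((h₁.pow 2).const_mul c₁₁)).add
    ((h₁.mul h₂).const_mul c₁₂)).add ((h₂.pow 2).const_mul c₂₂)
  refine congr($h.fderiv v).trans ?_
  simp only [Nat.add_one_sub_one, pow_one, nsmul_eq_mul, Nat.cast_ofNat, smul_add, add_apply,
    smul_apply, ContinuousLinearMap.coe_fst', ContinuousLinearMap.coe_snd', smul_eq_mul]
  ring

theorem exists_eq_quadratic (hU : IsPreconnected (U : Set (ℂ × ℂ))) (hf : DifferentiableOn ℂ f U)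
    {c₁ c₂ c₁₁ c₁₂ c₂₂ : ℂ}
    (h₁ : ∀ z ∈ U, fderiv ℂ f z (1, 0) = c₁ + 2 * c₁₁ * z.1 + c₁₂ * z.2)
    (h₂ : ∀ z ∈ U, fderiv ℂ f z (0, 1) = c₂ + c₁₂ * z.1 + 2 * c₂₂ * z.2) :
    ∃ c₀, ∀ z ∈ U,
      f z = c₁ * z.1 + c₂ * z.2 + c₁₁ * z.1 ^ 2 + c₁₂ * (z.1 * z.2) + c₂₂ * z.2 ^ 2 + c₀ := by
  refine U.isOpen.exists_eq_add_of_fderiv_eq hU hf (by fun_prop) fun z hz => ?_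
  ext <;> simp [fderiv_quadratic, h₁ z hz, h₂ z hz]

theorem exists_eq_affine_of_fderiv_separated (hU : IsPreconnected (U : Set (ℂ × ℂ)))
    {β γ : ℂ × ℂ → ℂ} (hβ : AnalyticOnNhd ℂ β U) (hγ : AnalyticOnNhd ℂ γ U)
    (hβ₂ : ∀ z ∈ U, fderiv ℂ β z (0, 1) = 0) (hγ₁ : ∀ z ∈ U, fderiv ℂ γ z (1, 0) = 0)
    (hβγ : ∀ z ∈ U, fderiv ℂ γ z (0, 1) = -fderiv ℂ β z (1, 0)) :
    ∃ b c k : ℂ, ∀ z ∈ U, β z = b - 2 * k * z.1 ∧ γ z = c + 2 * k * z.2 := by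
  have hγ₂₁ : ∀ z ∈ U, fderiv ℂ (fun y => fderiv ℂ γ y (0, 1)) z (1, 0) = 0 := fun z hz => by
    rw [fderiv_fderiv_comm (hγ z hz), fderiv_eq_of_eqOn hγ₁ hz]
    simp
  have hγ₂₂ : ∀ z ∈ U, fderiv ℂ (fun y => fderiv ℂ γ y (0, 1)) z (0, 1) = 0 := fun z hz => by
    rw [fderiv_eq_of_eqOn hβγ hz, fderiv_fun_neg, neg_apply, fderiv_fderiv_comm (hβ z hz),
      fderiv_eq_of_eqOn hβ₂ hz]
    simp
  obtain ⟨κ, hκ⟩ := U.isOpen.exists_is_const_of_fderiv_eq_zero hU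
    (f := fun z => fderiv ℂ γ z (0, 1))
    (analyticOnNhd_fderiv_apply hγ analyticOnNhd_const).differentiableOn
    (fun z hz => by ext <;> simp [hγ₂₁ z hz, hγ₂₂ z hz])
  obtain ⟨b, hb⟩ := exists_eq_quadratic hU hβ.differentiableOn
    (c₁ := -κ) (c₂ := 0) (c₁₁ := 0) (c₁₂ := 0) (c₂₂ := 0)
    (fun z hz => by linear_combination hβγ z hz - hκ z hz) (fun z hz => by simp [hβ₂ z hz])
  obtain ⟨c, hc⟩ := exists_eq_quadratic hU hγ.differentiableOn
    (c₁ := 0) (c₂ := κ) (c₁₁ := 0) (c₁₂ := 0) (c₂₂ := 0)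
    (fun z hz => by simp [hγ₁ z hz]) (fun z hz => by linear_combination hκ z hz)
  exact ⟨b, c, κ / 2, fun z hz =>
    ⟨by linear_combination hb z hz, by linear_combination hc z hz⟩⟩

theorem IsLeviSolution.exists_eq_quadratic (h : IsLeviSolution U a A B)
    (hU : IsPreconnected (U : Set (ℂ × ℂ))) (ha : AnalyticOnNhd ℂ a U)
    (hA : AnalyticOnNhd ℂ A U) (hB : AnalyticOnNhd ℂ B U) :
    ∃ a₀ b₀ b₁ c₀ c₁ k : ℂ, ∀ z ∈ U,
      a z = a₀ + c₁ * z.1 - b₁ * z.2 + 2 * k * (z.1 * z.2) ∧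
      A z = c₀ + c₁ * z.2 + k * z.2 ^ 2 ∧ B z = b₀ + b₁ * z.1 - k * z.1 ^ 2 := by
  obtain ⟨b₁, c₁, k, hβγ⟩ := exists_eq_affine_of_fderiv_separated hU
    (β := fun z => fderiv ℂ B z (1, 0)) (γ := fun z => fderiv ℂ A z (0, 1))
    (analyticOnNhd_fderiv_apply hB analyticOnNhd_const)
    (analyticOnNhd_fderiv_apply hA analyticOnNhd_const)
    (fun z hz => by
      rw [fderiv_fderiv_comm (hB z hz), fderiv_eq_of_eqOn h.fderiv_B_snd hz]
      simp)
    (fun z hz => by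
      rw [fderiv_fderiv_comm (hA z hz), fderiv_eq_of_eqOn h.fderiv_A_fst hz]
      simp)
    (fun z hz => by
      rw [fderiv_eq_of_eqOn h.fderiv_A_snd hz, fderiv_fderiv_comm (ha z hz),
        fderiv_eq_of_eqOn h.fderiv_a_snd hz, fderiv_fun_neg, neg_apply])
  obtain ⟨b₀, hb₀⟩ := RigidCR.exists_eq_quadratic hU hB.differentiableOn
    (c₁ := b₁) (c₂ := 0) (c₁₁ := -k) (c₁₂ := 0) (c₂₂ := 0)
    (fun z hz => by linear_combination (hβγ z hz).1) (fun z hz => by simp [h.fderiv_B_snd z hz])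
  obtain ⟨c₀, hc₀⟩ := RigidCR.exists_eq_quadratic hU hA.differentiableOn
    (c₁ := 0) (c₂ := c₁) (c₁₁ := 0) (c₁₂ := 0) (c₂₂ := k)
    (fun z hz => by simp [h.fderiv_A_fst z hz]) (fun z hz => by linear_combination (hβγ z hz).2)
  obtain ⟨a₀, ha₀⟩ := RigidCR.exists_eq_quadratic hU ha.differentiableOn
    (c₁ := c₁) (c₂ := -b₁) (c₁₁ := 0) (c₁₂ := 2 * k) (c₂₂ := 0)
    (fun z hz => by linear_combination (hβγ z hz).2 - h.fderiv_A_snd z hz)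
    (fun z hz => by linear_combination h.fderiv_a_snd z hz - (hβγ z hz).1)
  exact ⟨a₀, b₀, b₁, c₀, c₁, k, fun z hz => ⟨by linear_combination ha₀ z hz,
    by linear_combination hc₀ z hz, by linear_combination hb₀ z hz⟩⟩

end Integration

section Classification

variable {U : Opens (ℂ × ℂ)} {z : ℂ × ℂ}

/-- The coefficients of `∂_{z₁}` and `∂_{z₂}` of the general symmetry of the model. -/
def horizontalPart (μ b k : ℂ) (z : ℂ × ℂ) : ℂ × ℂ :=
  (μ * z.1 + b * z.2 - conj b + k * (z.1 * z.2), (μ - conj μ) * z.2 - conj k + k * z.2 ^ 2)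

/-- The part of the coefficient of `∂_w` of the general symmetry of the model that does not
involve `w`. -/
def verticalPart (τ : ℝ) (b k : ℂ) (z : ℂ × ℂ) : ℂ :=
  τ * Complex.I - 2 * b * z.1 - k * z.1 ^ 2

/-- The general symmetry of the model. In terms of the seven fields it is
`τ X¹ + (Re μ) X² + (Im μ) X³ + (Re b) X⁴ + (Im b) X⁵ + (Re k) X⁶ + (Im k) X⁷`. -/
def modelSymmetry (τ : ℝ) (μ b k : ℂ) : C3 → C3 :=
  rigidField (horizontalPart μ b k) (2 * μ.re) (verticalPart τ b k)

theorem fderiv_modelF_eq_iff (hz : 1 - z.2 * conj z.2 ≠ 0) {v : ℂ × ℂ} {α : ℝ} {β : ℂ} :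
    fderiv ℝ modelF z v = α * modelF z + β.re ↔
      ((2 * v.1 - α * z.1) * slope z + v.2 * slope z ^ 2 - β).re = 0 := by
  rw [fderiv_modelF hz, modelF_eq_re hz, ← Complex.re_ofReal_mul, ← Complex.add_re, ← sub_eq_zero,
    ← Complex.sub_re]
  ring_nf

theorem isRigidSymmetry_modelSymmetry (hdom : ∀ z ∈ U, 1 - z.2 * conj z.2 ≠ 0)
    (τ : ℝ) (μ b k : ℂ) :
    IsRigidSymmetry U modelF (horizontalPart μ b k) (2 * μ.re) (verticalPart τ b k) where
  analyticOnNhd_left z _ := by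
    have h : ContDiff ℂ ⊤ (horizontalPart μ b k) := by unfold horizontalPart; fun_prop
    exact h.contDiffAt.analyticAt
  analyticOnNhd_right z _ := by
    have h : ContDiff ℂ ⊤ (verticalPart τ b k) := by unfold verticalPart; fun_prop
    exact h.contDiffAt.analyticAt
  fderiv_apply z hz := by
    rw [fderiv_modelF_eq_iff (hdom z hz)]
    have hμ : ((2 * μ.re : ℝ) : ℂ) = μ + conj μ := (Complex.add_conj μ).symm
    have hz₁ : z.1 = conj (slope z) - z.2 * slope z := by
      rw [conj_slope (hdom z hz), add_sub_cancel_right]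
    set s := slope z
    suffices h : (2 * (horizontalPart μ b k z).1 - (2 * μ.re : ℝ) * z.1) * s +
        (horizontalPart μ b k z).2 * s ^ 2 - verticalPart τ b k z =
        (μ * (s * conj s) - conj (μ * (s * conj s))) +
          (2 * b * conj s - conj (2 * b * conj s)) +
          (k * conj s ^ 2 - conj (k * conj s ^ 2)) - τ * Complex.I by
      rw [h]
      simp only [Complex.add_re, Complex.sub_re, Complex.conj_re, sub_self,
        Complex.re_ofReal_mul, Complex.I_re, mul_zero, add_zero]
    simp only [horizontalPart, verticalPart, hμ, map_mul, map_pow, map_ofNat, Complex.conj_conj]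
    rw [hz₁]
    ring

theorem coeff_relations_of_tangency (hne : (U : Set (ℂ × ℂ)).Nonempty)
    (hdom : ∀ z ∈ U, 1 - z.2 * conj z.2 ≠ 0) {a₀ b₀ b₁ c₀ c₁ k : ℂ}
    (htan : ∀ z ∈ U, ((a₀ + c₁ * z.1 - b₁ * z.2 + 2 * k * (z.1 * z.2)) * slope z +
      (c₀ + c₁ * z.2 + k * z.2 ^ 2) * slope z ^ 2 - (b₀ + b₁ * z.1 - k * z.1 ^ 2)).re = 0) :
    b₀.re = 0 ∧ a₀ = conj b₁ ∧ c₁.re = 0 ∧ c₀ = -conj k := by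
  obtain ⟨z, hz⟩ := hne
  set γ : ℂ → ℂ × ℂ := fun σ => (conj σ - z.2 * σ, z.2)
  have hγ : Continuous γ := by
    have := Complex.continuous_conj
    fun_prop
  have hγz : γ (slope z) ∈ U := by simpa [γ, conj_slope (hdom z hz)] using hz
  obtain ⟨hb₀, ha₀, hc₁, hc₀⟩ := coeff_eq_zero_of_re_quadratic_eq_zero
    (U.isOpen.preimage hγ) ⟨slope z, hγz⟩
    (b := -b₀) (n := a₀ - conj b₁) (c := c₁) (m := c₀ + conj k) (fun σ hσ => by
      have h := htan (γ σ) hσ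
      rw [slope_conj_sub_mul (hdom z hz)] at h
      rw [← h, ← sub_eq_zero, ← Complex.sub_re]
      have hsplit : -b₀ + (a₀ - conj b₁) * σ + c₁ * (σ * conj σ) + (c₀ + conj k) * σ ^ 2 -
          ((a₀ + c₁ * (γ σ).1 - b₁ * (γ σ).2 + 2 * k * ((γ σ).1 * (γ σ).2)) * σ +
            (c₀ + c₁ * (γ σ).2 + k * (γ σ).2 ^ 2) * σ ^ 2 -
            (b₀ + b₁ * (γ σ).1 - k * (γ σ).1 ^ 2)) =
          (b₁ * conj σ - conj (b₁ * conj σ)) - (k * conj σ ^ 2 - conj (k * conj σ ^ 2)) := by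
        simp only [γ, map_mul, map_pow, Complex.conj_conj]
        ring
      rw [hsplit]
      simp only [Complex.sub_re, Complex.conj_re, sub_self])
  exact ⟨by simpa using hb₀, sub_eq_zero.1 ha₀, hc₁, eq_neg_of_add_eq_zero_left hc₀⟩

theorem IsRigidSymmetry.exists_eqOn_modelSymmetry {A : ℂ × ℂ → ℂ × ℂ} {α : ℝ} {B : ℂ × ℂ → ℂ}
    (h : IsRigidSymmetry U modelF A α B) (hU : IsConnected (U : Set (ℂ × ℂ)))
    (hdom : ∀ z ∈ U, 1 - z.2 * conj z.2 ≠ 0) :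
    ∃ τ μ b k, Set.EqOn (rigidField A α B) (modelSymmetry τ μ b k) (cylinder U) := by
  have hA₁ : AnalyticOnNhd ℂ (fun z => (A z).1) U := fun z hz =>
    analyticAt_fst.comp (h.analyticOnNhd_left z hz)
  have hA₂ : AnalyticOnNhd ℂ (fun z => (A z).2) U := fun z hz =>
    analyticAt_snd.comp (h.analyticOnNhd_left z hz)
  have ha : AnalyticOnNhd ℂ (fun z => 2 * (A z).1 - α * z.1) U :=
    (analyticOnNhd_const.mul hA₁).sub (analyticOnNhd_const.mul analyticOnNhd_fst)
  have htan := fun z hz => (fderiv_modelF_eq_iff (hdom z hz)).1 (h.fderiv_apply z hz)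
  obtain ⟨a₀, b₀, b₁, c₀, c₁, k, hsol⟩ :=
    (isLeviSolution_of_tangency hdom ha hA₂ h.analyticOnNhd_right htan).exists_eq_quadratic
      hU.isPreconnected ha hA₂ h.analyticOnNhd_right
  obtain ⟨hb₀, rfl, hc₁, rfl⟩ := coeff_relations_of_tangency hU.nonempty hdom fun z hz => by
    obtain ⟨ea, eA, eB⟩ := hsol z hz
    rw [← ea, ← eA, ← eB]
    exact htan z hz
  have hb₀' : (b₀.im : ℂ) * Complex.I = b₀ := by simpa [hb₀] using Complex.re_add_im b₀
  have hc₁' : c₁ + conj c₁ = 0 := by simp [Complex.add_conj, hc₁]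
  have hμ : 2 * ((α + c₁) / 2).re = α := by
    rw [Complex.div_ofNat_re, Complex.add_re, Complex.ofReal_re, hc₁]
    ring
  refine ⟨b₀.im, (α + c₁) / 2, -b₁ / 2, k, fun p hp => ?_⟩
  obtain ⟨ea, eA, eB⟩ := hsol p.1 hp.1
  simp only [modelSymmetry, rigidField, horizontalPart, verticalPart, hμ, eB, hb₀', map_add,
    map_neg, map_div₀, map_ofNat, Complex.conj_ofReal]
  refine Prod.ext (Prod.ext ?_ ?_) ?_
  · linear_combination ea / 2
  · linear_combination eA + p.1.2 * hc₁' / 2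
  · ring

theorem mem_holRigid_modelF_iff (hU : IsConnected (U : Set (ℂ × ℂ)))
    (hdom : ∀ z ∈ U, 1 - z.2 * conj z.2 ≠ 0) {X : HolVF (cylinder U)} :
    X ∈ holRigid U modelF ↔
      ∃ τ μ b k, Set.EqOn X.1 (modelSymmetry τ μ b k) (cylinder U) := by
  have hF : DifferentiableOn ℝ modelF U := fun z hz =>
    ((contDiffAt_modelF (hdom z hz)).differentiableAt two_ne_zero).differentiableWithinAt
  rw [mem_holRigid_iff hF]
  constructor
  · rintro ⟨A, α, B, hA, hX⟩
    obtain ⟨τ, μ, b, k, hsym⟩ := hA.exists_eqOn_modelSymmetry hU hdom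
    exact ⟨τ, μ, b, k, hX.trans hsym⟩
  · rintro ⟨τ, μ, b, k, hX⟩
    exact ⟨_, _, _, isRigidSymmetry_modelSymmetry hdom τ μ b k, hX⟩

theorem sum_smul_modelField_apply (θ : Fin 7 → ℝ) {p : C3} (hp : p ∈ cylinder U) :
    (∑ i, θ i • modelField U i).1 p = modelSymmetry (θ 0) ⟨θ 1, θ 2⟩ ⟨θ 3, θ 4⟩ ⟨θ 5, θ 6⟩ p := by
  have h (i : Fin 7) : (modelField U i).1 p = modelCoeff i p := HolVF.mk_apply hp
  rw [Submodule.coe_sum, Finset.sum_apply]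
  simp only [Submodule.coe_smul, Pi.smul_apply, h, Fin.sum_univ_seven, modelSymmetry, rigidField,
    horizontalPart, verticalPart, modelCoeff, Complex.mk_eq_add_mul_I, map_add, map_mul,
    Complex.conj_ofReal, Complex.conj_I, Matrix.cons_val, Prod.smul_mk, Prod.mk_add_mk,
    Complex.real_smul]
  refine Prod.ext (Prod.ext ?_ ?_) ?_ <;> push_cast <;> ring

theorem mem_span_modelField_iff {X : HolVF (cylinder U)} :
    X ∈ Submodule.span ℝ (Set.range (modelField U)) ↔
      ∃ τ μ b k, Set.EqOn X.1 (modelSymmetry τ μ b k) (cylinder U) := by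
  rw [Submodule.mem_span_range_iff_exists_fun]
  constructor
  · rintro ⟨θ, rfl⟩
    exact ⟨_, _, _, _, fun p hp => sum_smul_modelField_apply θ hp⟩
  · rintro ⟨τ, μ, b, k, hX⟩
    exact ⟨![τ, μ.re, μ.im, b.re, b.im, k.re, k.im], HolVF.ext_on fun p hp =>
      (sum_smul_modelField_apply _ hp).trans (hX hp).symm⟩

theorem eq_zero_of_modelSymmetry_eqOn_zero (hU : (U : Set (ℂ × ℂ)).Nonempty) {τ : ℝ} {μ b k : ℂ}
    (h : Set.EqOn (modelSymmetry τ μ b k) 0 (cylinder U)) : τ = 0 ∧ μ = 0 ∧ b = 0 ∧ k = 0 := by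
  have hfst : ContinuousLinearMap.fst ℂ ℂ ℂ ≠ 0 := fun h => one_ne_zero (α := ℂ) congr($h (1, 0))
  have hp {z : ℂ × ℂ} (hz : z ∈ U) : (z, (0 : ℂ)) ∈ cylinder U := ⟨hz, trivial⟩
  have hvert := coeff_eq_zero_of_sum_mul_pow_clm_eq_zero hfst U.isOpen hU
    (c := ![τ * Complex.I, -2 * b, -k]) (fun z hz => by
      have := congr($(h (hp hz)).2)
      simpa [modelSymmetry, rigidField, verticalPart, Fin.sum_univ_three, sub_eq_add_neg]
        using this)
  have hb : b = 0 := by simpa using hvert 1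
  have hk : k = 0 := by simpa using hvert 2
  have hhoriz := coeff_eq_zero_of_sum_mul_pow_clm_eq_zero hfst U.isOpen hU
    (c := ![0, μ]) (fun z hz => by
      have := congr($(h (hp hz)).1.1)
      simpa [modelSymmetry, rigidField, horizontalPart, hb, hk] using this)
  exact ⟨by simpa using hvert 0, hhoriz 1, hb, hk⟩

theorem linearIndependent_modelField (hU : (U : Set (ℂ × ℂ)).Nonempty) :
    LinearIndependent ℝ (modelField U) := by
  rw [Fintype.linearIndependent_iff]
  intro θ hθ
  obtain ⟨hτ, hμ, hb, hk⟩ := eq_zero_of_modelSymmetry_eqOn_zero hU fun p hp =>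
    (sum_smul_modelField_apply θ hp).symm.trans congr(($hθ).1 p)
  rw [Complex.ext_iff] at hμ hb hk
  simpa [Fin.forall_fin_succ] using ⟨hτ, hμ.1, hμ.2, hb.1, hb.2, hk.1, hk.2⟩

end Classification

end RigidCR

theorem proposition1p1 (U : TopologicalSpace.Opens (ℂ × ℂ))
    (hconn : IsConnected (U : Set (ℂ × ℂ)))
    (hdom : ∀ z ∈ U, 1 - z.2 * (starRingEnd ℂ) z.2 ≠ 0) :
    ∃ h : LieSubalgebra ℝ (RigidCR.HolVF (RigidCR.cylinder U)),
      (h : Set (RigidCR.HolVF (RigidCR.cylinder U))) = RigidCR.holRigid U RigidCR.modelF ∧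
      Module.finrank ℝ h = 7 ∧
      LinearIndependent ℝ (RigidCR.modelField U) ∧
      Submodule.span ℝ (Set.range (RigidCR.modelField U)) = h.toSubmodule := by
  have hF : ContDiffOn ℝ 2 RigidCR.modelF U := fun z hz =>
    (RigidCR.contDiffAt_modelF (hdom z hz)).contDiffWithinAt
  have hli := RigidCR.linearIndependent_modelField hconn.nonempty
  set h := RigidCR.holRigidLieSubalgebra U RigidCR.modelF hF
  have hspan : Submodule.span ℝ (Set.range (RigidCR.modelField U)) = h.toSubmodule :=
    Submodule.ext fun _ => RigidCR.mem_span_modelField_iff.trans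
      (RigidCR.mem_holRigid_modelF_iff hconn hdom).symm
  have hdim : Module.finrank ℝ h = 7 := by
    rw [← Fintype.card_fin 7, ← finrank_span_eq_card hli, hspan]
    rfl
  exact ⟨h, rfl, hdim, hli, hspan⟩
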